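/- **Theorem.** Call a Turing degree a *c.e. degree* if it is the Turing degree of some computably enumerable (c.e.) set of natural numbers, and let $\mathbf{0}'$ be the Turing degree of the halting set. For $A, B \subseteq \mathbb{N}$, a *separator* of $A$ and $B$ is a set $Z \subseteq \mathbb{N}$ with $A \subseteq Z$ and $Z \cap B = \emptyset$. Then for every c.e. degree $\mathbf{c}$ there are c.e. sets $A, B \subseteq \mathbb{N}$ with $A \cap B = \emptyset$ and $\mathbb{N} \setminus (A \cup B)$ infinite such that $$\{\mathbf{w} : \mathbf{w} \text{ is a c.e. degree and } \mathbf{w} = \deg_T(Z) \text{ for some separator } Z \text{ of } A \text{ and } B\} = \{\mathbf{c}, \mathbf{0}'\}.$$ Moreover $A$ and $B$ can be chosen so that $\deg_T(A) = \mathbf{0}'$ and $\deg_T(\mathbb{N} \setminus B) = \mathbf{c}$. -/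

import Mathlib

namespace SeparatingSpectra

/-- A set of natural numbers is computably enumerable. -/
def IsCE (X : Set ℕ) : Prop := REPred fun n : ℕ => n ∈ X

open Classical in
/-- The (total) characteristic function of `X`, as an oracle. -/
noncomputable def charFun (X : Set ℕ) : ℕ →. ℕ :=
  fun n => Part.some (if n ∈ X then 1 else 0)

/-- The Turing degree of a set of natural numbers. -/
noncomputable def deg (X : Set ℕ) : TuringDegree :=
  toAntisymmetrization TuringReducible (charFun X)

/-- A c.e. degree: the Turing degree of some c.e. set. -/
def IsCEDegree (w : TuringDegree) : Prop := ∃ W : Set ℕ, IsCE W ∧ deg W = w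

/-- The diagonal halting set `K = {e | φ_e(e)↓}`. -/
def haltingSet : Set ℕ := {e | ((Denumerable.ofNat Nat.Partrec.Code e).eval e).Dom}

/-- The degree `0'` of the halting set. -/
noncomputable def zeroJump : TuringDegree := deg haltingSet

/-- The separating class `S(A, B) = {Z | A ⊆ Z, Z ∩ B = ∅}`. -/
def separatingClass (A B : Set ℕ) : Set (Set ℕ) := {Z | A ⊆ Z ∧ Z ∩ B = ∅}

/-- The c.e. degrees realized in a class of sets of natural numbers. -/
def spectrum (P : Set (Set ℕ)) : Set TuringDegree := {w | IsCEDegree w ∧ ∃ Z ∈ P, deg Z = w}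

end SeparatingSpectra

namespace SeparatingSpectra

open Nat.Partrec (Code)
open Nat.Partrec.Code (eval evaln)
open Encodable Denumerable

/-! Fix a co-infinite c.e. set `C` of the given degree. Split ℕ into columns, reserve a finite block
in column `c`, and put everything beyond the block into `A`. If `c` enters `C`, what remains of the
block goes into `B`; since some element always remains, `B` and `C` have the same degree
(`deg_codeSet`). Any separator that omits only finitely many points outside `B` is a finite variant
of the complement of `B`, so it has the given degree (`deg_eq_of_finite`).

Every other separator `Z` of c.e. degree must compute the halting set `K`. Since `Z` is Turing
equivalent to a c.e. set, some computable `guess e` converges to `Z` with a modulus recursive in `Z`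
(`exists_guess_modulus`). Whenever some `k ≤ c` enters `K`, or `c` enters `C`, while `c` was not yet
in `C`, each `e ≤ c` has one block element dumped into `A` that its current guess places outside
`Z`, if there is a fresh one. If the guess is already correct, this puts a point outside `Z` into `A
⊆ Z`, which is absurd. So when `Z` visibly omits a point of column `c` and that point is not in `B`
by the modulus stage, no further event can occur, and `K` is settled up to `c` (`halting_settled`).
Infinitely many omitted points outside `B` give such columns beyond any bound
(`haltingSet_turingReducible`).

Column `c` has at most `c + 2` events, each dumping at most `c + 1` elements, so a block of size `(c
+ 1) * (c + 2) + 1` keeps a survivor (`exists_not_dumped`). The survivors in columns outside `C`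
make the complement of `A ∪ B` infinite, hence `A` itself is a separator of the second kind and has
degree `0'`. -/

/-! ### Oracle computation through finite initial segments. -/

/-- The list of the first `n` values of `o`. -/
def initSeg (o : ℕ → ℕ) (n : ℕ) : List ℕ := (List.range n).map o

@[simp] theorem length_initSeg (o : ℕ → ℕ) (n : ℕ) : (initSeg o n).length = n := by
  simp [initSeg]

theorem initSeg_succ (o : ℕ → ℕ) (n : ℕ) : initSeg o (n + 1) = initSeg o n ++ [o n] := by
  simp [initSeg, List.range_succ]

theorem initSeg_getElem? (o : ℕ → ℕ) {n i : ℕ} (h : i < n) : (initSeg o n)[i]? = some (o i) := by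
  simp [initSeg, h]

theorem initSeg_prefix (o : ℕ → ℕ) {m n : ℕ} (h : m ≤ n) : initSeg o m <+: initSeg o n := by
  induction n, h using Nat.le_induction with
  | base => exact List.prefix_rfl
  | succ n _ ih => rw [initSeg_succ]; exact ih.trans (List.prefix_append _ _)

theorem take_initSeg (o : ℕ → ℕ) {m n : ℕ} (h : m ≤ n) : (initSeg o n).take m = initSeg o m := by
  have := (List.prefix_iff_eq_take.1 (initSeg_prefix o h)).symm
  simpa using this

theorem recursiveIn_initSeg (o : ℕ → ℕ) :
    Nat.RecursiveIn {(o : ℕ →. ℕ)} (fun n => Part.some (encode (initSeg o n))) := by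
  have step : Computable fun p : ℕ =>
      encode ((ofNat (List ℕ) p.unpair.1.unpair.2.unpair.2) ++ [p.unpair.2]) := by
    refine Primrec.to_comp (Primrec.encode.comp (Primrec.list_concat.comp
      ((Primrec.ofNat _).comp ?_) ?_))
    · exact Primrec.snd.comp (Primrec.unpair.comp (Primrec.snd.comp (Primrec.unpair.comp
        (Primrec.fst.comp Primrec.unpair))))
    · exact Primrec.snd.comp Primrec.unpair
  have hstep : Nat.RecursiveIn {(o : ℕ →. ℕ)} (fun p : ℕ => Part.some
      (encode ((ofNat (List ℕ) p.unpair.1.unpair.2.unpair.2) ++ [p.unpair.2]))) :=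
    Nat.Partrec.recursiveIn (Partrec.nat_iff.1 step)
  have hid : Nat.RecursiveIn {(o : ℕ →. ℕ)} (fun p : ℕ => Part.some p) :=
    Nat.Partrec.recursiveIn Nat.Partrec.some
  have ho : Nat.RecursiveIn {(o : ℕ →. ℕ)} (fun p : ℕ => Part.some (o p.unpair.2.unpair.1)) := by
    refine (Nat.RecursiveIn.comp (Nat.RecursiveIn.oracle _ (Set.mem_singleton _))
      (Nat.RecursiveIn.comp Nat.RecursiveIn.left Nat.RecursiveIn.right)).of_eq fun n => ?_
    simp only [Part.coe_some, Part.bind_eq_bind, Part.bind_some]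
    exact Part.bind_some _ _
  have hnil : Nat.RecursiveIn {(o : ℕ →. ℕ)} (fun _ => Part.some (encode ([] : List ℕ))) :=
    Nat.Partrec.recursiveIn (Partrec.nat_iff.1 (Computable.const _))
  have hrec := Nat.RecursiveIn.prec hnil (Nat.RecursiveIn.comp hstep (Nat.RecursiveIn.pair hid ho))
  have hz : Nat.RecursiveIn {(o : ℕ →. ℕ)} (fun n : ℕ => Part.some (Nat.pair 0 n)) :=
    Nat.Partrec.recursiveIn (Partrec.nat_iff.1
      (Primrec.to_comp (Primrec₂.natPair.comp (Primrec.const 0) Primrec.id)))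
  refine (Nat.RecursiveIn.comp hrec hz).of_eq fun n => ?_
  simp only [Part.bind_eq_bind, Part.bind_some, Nat.unpair_pair]
  induction n with
  | zero => simp [initSeg]
  | succ n ih =>
    simp only [ih, Part.bind_some, initSeg_succ]
    simp [Seq.seq]

/-- Unbounded search through the initial segments of an oracle. -/
theorem exists_turingReducible_of_search (o : ℕ → ℕ) {F : List ℕ → ℕ → Option ℕ}
    (hF : Computable₂ F) (hdom : ∀ x, ∃ n, (F (initSeg o n) x).isSome) :
    ∃ f : ℕ → ℕ, TuringReducible f o ∧ ∀ x, ∃ n, F (initSeg o n) x = some (f x) := by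
  let test : ℕ → ℕ := fun p => if (F (ofNat (List ℕ) p.unpair.2) p.unpair.1).isSome then 0 else 1
  let val : ℕ → ℕ := fun p => (F (ofNat (List ℕ) p.unpair.2) p.unpair.1).getD 0
  have hFu : Computable fun p : ℕ => F (ofNat (List ℕ) p.unpair.2) p.unpair.1 :=
    hF.comp ((Primrec.ofNat _).to_comp.comp (Computable.snd.comp Computable.unpair))
      (Computable.fst.comp Computable.unpair)
  have htest : Computable test := by
    refine (Computable.cond (Primrec.option_isSome.to_comp.comp hFu) (Computable.const 0)
      (Computable.const 1)).of_eq fun p => ?_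
    simp only [test]; cases (F (ofNat (List ℕ) p.unpair.2) p.unpair.1) <;> rfl
  have hval : Computable val := Computable.option_getD hFu (Computable.const 0)
  have lift : ∀ {g : ℕ → ℕ}, Computable g →
      Nat.RecursiveIn {(o : ℕ →. ℕ)} (fun p => Part.some (g p)) :=
    fun hg => Nat.Partrec.recursiveIn (Partrec.nat_iff.1 hg)
  have hseg : Nat.RecursiveIn {(o : ℕ →. ℕ)}
      (fun p => Part.some (Nat.pair p.unpair.1 (encode (initSeg o p.unpair.2)))) := by
    refine (Nat.RecursiveIn.pair Nat.RecursiveIn.left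
      (Nat.RecursiveIn.comp (recursiveIn_initSeg o) Nat.RecursiveIn.right)).of_eq fun n => ?_
    simp [Seq.seq]
  have hsearch := Nat.RecursiveIn.rfind (Nat.RecursiveIn.comp (lift htest) hseg)
  have hall := Nat.RecursiveIn.comp (Nat.RecursiveIn.comp (lift hval) hseg)
    (Nat.RecursiveIn.pair (lift Computable.id) hsearch)
  classical
  refine ⟨fun x => (F (initSeg o (Nat.find (hdom x))) x).getD 0, ?_, fun x => ?_⟩
  · rw [TuringReducible, RecursiveIn.iff_nat]
    refine hall.of_eq fun x => ?_
    have hr : (Nat.rfind fun n => (fun m => decide (m = 0)) <$>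
        ((Part.some (Nat.pair (Nat.pair x n).unpair.1 (encode (initSeg o (Nat.pair x n).unpair.2))) :
          Part ℕ) >>= fun p => Part.some (test p))) = Part.some (Nat.find (hdom x)) := by
      refine Part.eq_some_iff.2 (Nat.mem_rfind.2 ⟨?_, fun {m} hm => ?_⟩)
      · have := Nat.find_spec (hdom x)
        simp [test, this]
      · have := Nat.find_min (hdom x) hm
        simp [test, this]
    simp only [id, hr]
    simp [Seq.seq, val]
  · refine ⟨Nat.find (hdom x), ?_⟩
    obtain ⟨y, hy⟩ := Option.isSome_iff_exists.1 (Nat.find_spec (hdom x))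
    simp [hy]

/-- This is the working criterion for reductions: answers need only be right on true initial
segments of the oracle, so a procedure may return `none` until its segment is long enough and may
use that length as a stage. -/
theorem turingReducible_of_search {f o : ℕ → ℕ} {F : List ℕ → ℕ → Option ℕ}
    (hF : Computable₂ F) (hdom : ∀ x, ∃ n, (F (initSeg o n) x).isSome)
    (hsound : ∀ x n y, F (initSeg o n) x = some y → y = f x) : TuringReducible f o := by
  obtain ⟨g, hg, hgF⟩ := exists_turingReducible_of_search o hF hdom
  have : g = f := funext fun x => let ⟨n, hn⟩ := hgF x; hsound x n _ hn
  exact this ▸ hg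

/-- The use principle: a function recursive in `o` is the union, along the initial segments
of `o`, of a monotone partial recursive functional on finite strings. -/
theorem exists_functional {o : ℕ → ℕ} {f : ℕ →. ℕ} (hf : Nat.RecursiveIn {(o : ℕ →. ℕ)} f) :
    ∃ F : List ℕ → ℕ →. ℕ, Partrec₂ F ∧
      (∀ σ τ x y, σ <+: τ → y ∈ F σ x → y ∈ F τ x) ∧
      ∀ x y, y ∈ f x → ∃ n, y ∈ F (initSeg o n) x := by
  have triv : ∀ g : ℕ → ℕ, Primrec g → ∃ F : List ℕ → ℕ →. ℕ, Partrec₂ F ∧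
      (∀ σ τ x y, σ <+: τ → y ∈ F σ x → y ∈ F τ x) ∧
      ∀ x y, y ∈ Part.some (g x) → ∃ n, y ∈ F (initSeg o n) x := fun g hg =>
    ⟨fun _ x => Part.some (g x), (hg.to_comp.comp Computable.snd).partrec,
      fun _ _ _ _ _ h => h, fun _ _ h => ⟨0, h⟩⟩
  induction hf with
  | zero => exact triv (fun _ => 0) (Primrec.const 0)
  | succ => exact triv Nat.succ Primrec.succ
  | left => exact triv (fun n => n.unpair.1) (Primrec.fst.comp Primrec.unpair)
  | right => exact triv (fun n => n.unpair.2) (Primrec.snd.comp Primrec.unpair)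
  | oracle g hg =>
    cases hg
    refine ⟨fun σ x => (σ[x]? : Option ℕ), Computable.ofOption Computable.list_getElem?, ?_, ?_⟩
    · rintro σ τ x y ⟨ρ, rfl⟩ h
      simp only [Part.mem_ofOption, Option.mem_def] at h ⊢
      obtain ⟨hlt, -⟩ := List.getElem?_eq_some_iff.1 h
      rw [List.getElem?_append_left hlt, h]
    · intro x y h
      refine ⟨x + 1, ?_⟩
      change y ∈ ((initSeg o (x + 1))[x]? : Part ℕ)
      rw [initSeg_getElem? o (Nat.lt_succ_self x)]
      exact h
  | @pair f h _ _ ihf ihh =>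
    obtain ⟨F, hF, mF, eF⟩ := ihf
    obtain ⟨H, hH, mH, eH⟩ := ihh
    refine ⟨fun σ x => (F σ x).bind fun a => (H σ x).map fun b => Nat.pair a b, ?_, ?_, ?_⟩
    · refine Partrec.bind hF (Partrec.map (hH.comp (Computable.fst.comp Computable.fst)
        (Computable.snd.comp Computable.fst)) ?_)
      exact Primrec₂.natPair.to_comp.comp (Computable.snd.comp Computable.fst) Computable.snd
    · intro σ τ x y hst hy
      simp only [Part.mem_bind_iff, Part.mem_map_iff] at hy ⊢
      obtain ⟨a, ha, b, hb, rfl⟩ := hy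
      exact ⟨a, mF _ _ _ _ hst ha, b, mH _ _ _ _ hst hb, rfl⟩
    · intro x y hy
      simp only [Seq.seq, Part.map_eq_map, Part.mem_bind_iff, Part.mem_map_iff] at hy
      obtain ⟨_, ⟨a, ha, rfl⟩, b, hb, rfl⟩ := hy
      obtain ⟨n, hn⟩ := eF _ _ ha
      obtain ⟨k, hk⟩ := eH _ _ hb
      refine ⟨max n k, ?_⟩
      simp only [Part.mem_bind_iff, Part.mem_map_iff]
      exact ⟨a, mF _ _ _ _ (initSeg_prefix o (le_max_left _ _)) hn, b,
        mH _ _ _ _ (initSeg_prefix o (le_max_right _ _)) hk, rfl⟩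
  | @comp f h _ _ ihf ihh =>
    obtain ⟨F, hF, mF, eF⟩ := ihf
    obtain ⟨H, hH, mH, eH⟩ := ihh
    refine ⟨fun σ x => (H σ x).bind fun a => F σ a, ?_, ?_, ?_⟩
    · exact Partrec.bind hH (hF.comp (Computable.fst.comp Computable.fst) Computable.snd)
    · intro σ τ x y hst hy
      simp only [Part.mem_bind_iff] at hy ⊢
      obtain ⟨a, ha, hb⟩ := hy
      exact ⟨a, mH _ _ _ _ hst ha, mF _ _ _ _ hst hb⟩
    · intro x y hy
      obtain ⟨a, ha, hb⟩ := Part.mem_bind_iff.1 hy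
      obtain ⟨n, hn⟩ := eH _ _ ha
      obtain ⟨k, hk⟩ := eF _ _ hb
      refine ⟨max n k, ?_⟩
      simp only [Part.mem_bind_iff]
      exact ⟨a, mH _ _ _ _ (initSeg_prefix o (le_max_left _ _)) hn,
        mF _ _ _ _ (initSeg_prefix o (le_max_right _ _)) hk⟩
  | @prec f h _ _ ihf ihh =>
    obtain ⟨F, hF, mF, eF⟩ := ihf
    obtain ⟨H, hH, mH, eH⟩ := ihh
    have mono : ∀ σ τ a y n, σ <+: τ →
        y ∈ (Nat.rec (F σ a) (fun y IH => IH.bind fun i =>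
          H σ (Nat.pair a (Nat.pair y i))) n : Part ℕ) →
        y ∈ (Nat.rec (F τ a) (fun y IH => IH.bind fun i =>
          H τ (Nat.pair a (Nat.pair y i))) n : Part ℕ) := by
      intro σ τ a y n hst
      induction n generalizing y with
      | zero => exact mF _ _ _ _ hst
      | succ n ih =>
        intro hy
        simp only [Part.mem_bind_iff] at hy ⊢
        obtain ⟨i, hi, hy⟩ := hy
        exact ⟨i, ih _ hi, mH _ _ _ _ hst hy⟩
    refine ⟨fun σ x => Nat.rec (F σ x.unpair.1)
      (fun y IH => IH.bind fun i => H σ (Nat.pair x.unpair.1 (Nat.pair y i))) x.unpair.2,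
      ?_, ?_, ?_⟩
    · refine Partrec.nat_rec (f := fun p : List ℕ × ℕ => p.2.unpair.2)
        (g := fun p : List ℕ × ℕ => F p.1 p.2.unpair.1)
        (h := fun (p : List ℕ × ℕ) (q : ℕ × ℕ) =>
          H p.1 (Nat.pair p.2.unpair.1 (Nat.pair q.1 q.2))) ?_ ?_ ?_
      · exact (Primrec.snd.comp (Primrec.unpair.comp Primrec.snd)).to_comp
      · exact hF.comp Computable.fst (Primrec.fst.comp (Primrec.unpair.comp Primrec.snd)).to_comp
      · refine hH.comp (Computable.fst.comp Computable.fst) (Primrec.to_comp ?_)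
        refine Primrec₂.natPair.comp
          (Primrec.fst.comp (Primrec.unpair.comp (Primrec.snd.comp Primrec.fst)))
          (Primrec₂.natPair.comp (Primrec.fst.comp Primrec.snd) (Primrec.snd.comp Primrec.snd))
    · exact fun σ τ x y hst => mono _ _ _ _ _ hst
    · intro x y
      dsimp only
      generalize x.unpair.2 = n
      induction n generalizing y with
      | zero => exact eF _ _
      | succ n ih =>
        intro hy
        simp only [Part.bind_eq_bind, Part.mem_bind_iff] at hy ⊢
        obtain ⟨i, hi, hy⟩ := hy
        obtain ⟨n₁, h₁⟩ := ih _ hi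
        obtain ⟨n₂, h₂⟩ := eH _ _ hy
        exact ⟨max n₁ n₂, i, mono _ _ _ _ _ (initSeg_prefix o (le_max_left _ _)) h₁,
          mH _ _ _ _ (initSeg_prefix o (le_max_right _ _)) h₂⟩
  | @rfind f _ ihf =>
    obtain ⟨F, hF, mF, eF⟩ := ihf
    refine ⟨fun σ x => Nat.rfind fun n => (F σ (Nat.pair x n)).map fun m => decide (m = 0),
      ?_, ?_, ?_⟩
    · refine Partrec.rfind (Partrec.map (hF.comp (Computable.fst.comp Computable.fst)
        (Primrec₂.natPair.to_comp.comp (Computable.snd.comp Computable.fst) Computable.snd)) ?_)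
      exact (PrimrecPred.decide (Primrec.eq.comp Primrec.snd (Primrec.const 0))).to_comp
    · intro σ τ x y hst hy
      obtain ⟨h0, hlt⟩ := Nat.mem_rfind.1 hy
      obtain ⟨a, ha, h0⟩ := (Part.mem_map_iff _).1 h0
      refine Nat.mem_rfind.2 ⟨(Part.mem_map_iff _).2 ⟨a, mF _ _ _ _ hst ha, h0⟩, fun hm => ?_⟩
      obtain ⟨b, hb, h1⟩ := (Part.mem_map_iff _).1 (hlt hm)
      exact (Part.mem_map_iff _).2 ⟨b, mF _ _ _ _ hst hb, h1⟩
    · intro x y hy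
      obtain ⟨h0, hlt⟩ := Nat.mem_rfind.1 hy
      obtain ⟨a, ha, h0⟩ := (Part.mem_map_iff _).1 h0
      -- The finitely many unsuccessful tests below `y` need one common segment of the oracle;
      -- monotonicity allows the longest one to serve.
      have key : ∀ k ≤ y, ∃ n, ∀ m < k, ∃ b ∈ F (initSeg o n) (Nat.pair x m),
          decide (b = 0) = false := by
        intro k
        induction k with
        | zero => exact fun _ => ⟨0, by simp⟩
        | succ k ih =>
          intro hk
          obtain ⟨n₁, h₁⟩ := ih (by lia)
          obtain ⟨b, hb, hb0⟩ := (Part.mem_map_iff _).1 (hlt (show k < y by lia))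
          obtain ⟨n₂, h₂⟩ := eF _ _ hb
          refine ⟨max n₁ n₂, fun m hm => ?_⟩
          rcases Nat.lt_succ_iff_lt_or_eq.1 hm with hm | rfl
          · obtain ⟨b, hb, hb0⟩ := h₁ m hm
            exact ⟨b, mF _ _ _ _ (initSeg_prefix o (le_max_left _ _)) hb, hb0⟩
          · exact ⟨b, mF _ _ _ _ (initSeg_prefix o (le_max_right _ _)) h₂, hb0⟩
      obtain ⟨n₁, h₁⟩ := key y le_rfl
      obtain ⟨n₂, h₂⟩ := eF _ _ ha
      refine ⟨max n₁ n₂, Nat.mem_rfind.2 ⟨(Part.mem_map_iff _).2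
        ⟨a, mF _ _ _ _ (initSeg_prefix o (le_max_right _ _)) h₂, h0⟩, fun {m} hm => ?_⟩⟩
      obtain ⟨b, hb, hb0⟩ := h₁ m hm
      exact (Part.mem_map_iff _).2 ⟨b, mF _ _ _ _ (initSeg_prefix o (le_max_left _ _)) hb, hb0⟩

/-! ### Stagewise approximations, guesses and their moduli. -/

/-- The stage-`s` approximation to the domain of the code `d`. -/
def inDom (d : Code) (s i : ℕ) : Bool := (evaln s d i).isSome

theorem inDom_mono {d : Code} {s t i : ℕ} (hst : s ≤ t) (h : inDom d s i) : inDom d t i := by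
  obtain ⟨y, hy⟩ := Option.isSome_iff_exists.1 h
  exact Option.isSome_iff_exists.2 ⟨y, Nat.Partrec.Code.evaln_mono hst hy⟩

theorem exists_inDom_iff {d : Code} {i : ℕ} : (∃ s, inDom d s i) ↔ (eval d i).Dom := by
  constructor
  · rintro ⟨s, h⟩
    obtain ⟨y, hy⟩ := Option.isSome_iff_exists.1 h
    exact Part.dom_iff_mem.2 ⟨y, Nat.Partrec.Code.evaln_sound hy⟩
  · intro h
    obtain ⟨y, hy⟩ := Part.dom_iff_mem.1 h
    obtain ⟨s, hs⟩ := Nat.Partrec.Code.evaln_complete.1 hy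
    exact ⟨s, Option.isSome_iff_exists.2 ⟨y, hs⟩⟩

theorem primrec_inDom : Primrec fun p : (ℕ × Code) × ℕ => inDom p.1.2 p.1.1 p.2 :=
  Primrec.option_isSome.comp Nat.Partrec.Code.primrec_evaln

/-- `d` enumerates the set `W`. -/
def Enumerates (d : Code) (W : Set ℕ) : Prop := ∀ i, i ∈ W ↔ ∃ s, inDom d s i

theorem IsCE.exists_enumerates {W : Set ℕ} (hW : IsCE W) : ∃ d, Enumerates d W := by
  have h : Partrec fun n : ℕ => (Part.assert (n ∈ W) fun _ => Part.some ()).map fun _ => (0 : ℕ) :=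
    Partrec.map hW (Computable.const 0).to₂
  obtain ⟨d, hd⟩ := Nat.Partrec.Code.exists_code.1 (Partrec.nat_iff.1 h)
  refine ⟨d, fun i => ?_⟩
  rw [exists_inDom_iff, hd]
  simp [Part.assert]

/-- The characteristic function of a set, as a total function. -/
noncomputable def chi (X : Set ℕ) : ℕ → ℕ := open Classical in fun n => if n ∈ X then 1 else 0

theorem chi_eq_one {X : Set ℕ} {n : ℕ} : chi X n = 1 ↔ n ∈ X := by simp [chi]

theorem chi_eq_zero {X : Set ℕ} {n : ℕ} : chi X n = 0 ↔ n ∉ X := by simp [chi]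

theorem chi_congr {X Y : Set ℕ} {m n : ℕ} (h : m ∈ X ↔ n ∈ Y) : chi X m = chi Y n := by
  by_cases hn : n ∈ Y
  · rw [chi_eq_one.2 hn, chi_eq_one.2 (h.2 hn)]
  · rw [chi_eq_zero.2 hn, chi_eq_zero.2 (mt h.1 hn)]

/-- The stage-`s` approximation to the characteristic function of the domain of `d`. -/
def stageChi (d : Code) (s i : ℕ) : ℕ := if inDom d s i then 1 else 0

theorem Enumerates.exists_stage {d : Code} {W : Set ℕ} (h : Enumerates d W) (n : ℕ) :
    ∃ t, ∀ s, t ≤ s → initSeg (stageChi d s) n = initSeg (chi W) n := by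
  induction n with
  | zero => exact ⟨0, fun _ _ => rfl⟩
  | succ n ih =>
    obtain ⟨t, ht⟩ := ih
    by_cases hn : n ∈ W
    · obtain ⟨s₀, hs₀⟩ := (h n).1 hn
      refine ⟨max t s₀, fun s hs => ?_⟩
      rw [initSeg_succ, initSeg_succ, ht s (le_trans (le_max_left _ _) hs), chi_eq_one.2 hn]
      simp [stageChi, inDom_mono (le_trans (le_max_right _ _) hs) hs₀]
    · refine ⟨t, fun s hs => ?_⟩
      have : ¬ inDom d s n := fun hs => hn ((h n).2 ⟨s, hs⟩)
      rw [initSeg_succ, initSeg_succ, ht s hs, chi_eq_zero.2 hn]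
      simp [stageChi, this]

/-- The approximation changes only from 0 to 1, so a segment that is once correct stays correct.
This is what lets the enumerated set compute a modulus. -/
theorem Enumerates.initSeg_eq_of_le {d : Code} {W : Set ℕ} (h : Enumerates d W) {n s t : ℕ}
    (hst : s ≤ t) (hs : initSeg (stageChi d s) n = initSeg (chi W) n) :
    initSeg (stageChi d t) n = initSeg (chi W) n := by
  refine List.map_congr_left fun i hi => ?_
  have hi' : stageChi d s i = chi W i := List.map_inj_left.1 hs i hi
  by_cases hiW : i ∈ W
  · rw [chi_eq_one.2 hiW] at hi' ⊢
    have : inDom d s i := by by_contra hc; simp [stageChi, hc] at hi'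
    simp [stageChi, inDom_mono hst this]
  · have : ¬ inDom d t i := fun ht => hiW ((h i).2 ⟨t, ht⟩)
    rw [chi_eq_zero.2 hiW]
    simp [stageChi, this]

/-- Simulated computation, where `e` codes a functional and an enumeration: the first value that the
functional yields within `s` steps on an initial segment of the stage-`s` approximation to the
enumerated set. -/
def guess (e c s : ℕ) : ℕ :=
  (((List.range (s + 1)).filterMap fun n => evaln s (ofNat Code e.unpair.1)
    (Nat.pair (encode (initSeg (stageChi (ofNat Code e.unpair.2) s) n)) c)).head?).getD 0

theorem primrec_initSeg_stageChi :
    Primrec fun p : (ℕ × Code) × ℕ => initSeg (stageChi p.1.2 p.1.1) p.2 := by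
  refine Primrec.list_map (Primrec.list_range.comp Primrec.snd)
    (Primrec.ite (PrimrecPred.comp (p := fun b : Bool => b = true)
      (Primrec.eq.comp Primrec.id (Primrec.const true)) ?_) (Primrec.const 1) (Primrec.const 0))
  exact primrec_inDom.comp (Primrec.pair (Primrec.fst.comp Primrec.fst) Primrec.snd)

theorem primrec_guess : Primrec fun p : (ℕ × ℕ) × ℕ => guess p.1.1 p.1.2 p.2 := by
  have he : Primrec fun q : ((ℕ × ℕ) × ℕ) × ℕ => q.1.1.1 :=
    Primrec.fst.comp (Primrec.fst.comp Primrec.fst)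
  have hs : Primrec fun q : ((ℕ × ℕ) × ℕ) × ℕ => q.1.2 := Primrec.snd.comp Primrec.fst
  have hc : Primrec fun q : ((ℕ × ℕ) × ℕ) × ℕ => q.1.1.2 :=
    Primrec.snd.comp (Primrec.fst.comp Primrec.fst)
  have h1 : Primrec fun q : ((ℕ × ℕ) × ℕ) × ℕ => ofNat Code q.1.1.1.unpair.1 :=
    (Primrec.ofNat Code).comp (Primrec.fst.comp (Primrec.unpair.comp he))
  have h2 : Primrec fun q : ((ℕ × ℕ) × ℕ) × ℕ => ofNat Code q.1.1.1.unpair.2 :=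
    (Primrec.ofNat Code).comp (Primrec.snd.comp (Primrec.unpair.comp he))
  refine Primrec.option_getD.comp (Primrec.list_head?.comp (Primrec.listFilterMap
    (Primrec.list_range.comp (Primrec.succ.comp Primrec.snd)) ?_)) (Primrec.const 0)
  exact Nat.Partrec.Code.primrec_evaln.comp (Primrec.pair (Primrec.pair hs h1)
    (Primrec₂.natPair.comp (Primrec.encode.comp
      (primrec_initSeg_stageChi.comp (Primrec.pair (Primrec.pair hs h2) Primrec.snd))) hc))

/-- A total function recursive in a c.e. set `W` is the limit of some `guess e`, with a modulus
recursive in `W`. -/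
theorem exists_guess_modulus {d : Code} {W : Set ℕ} (hd : Enumerates d W) {f : ℕ → ℕ}
    (hf : TuringReducible f (chi W)) :
    ∃ (e : ℕ) (m : ℕ → ℕ), TuringReducible m (chi W) ∧ ∀ c s, m c ≤ s → guess e c s = f c := by
  obtain ⟨F, hF, mF, eF⟩ := exists_functional (RecursiveIn.iff_nat.1 hf)
  have hF' : Partrec fun p : ℕ => F (ofNat (List ℕ) p.unpair.1) p.unpair.2 :=
    hF.comp ((Primrec.ofNat _).comp (Primrec.fst.comp Primrec.unpair)).to_comp
      (Primrec.snd.comp Primrec.unpair).to_comp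
  obtain ⟨q, hq⟩ := Nat.Partrec.Code.exists_code.1 (Partrec.nat_iff.1 hF')
  have hqF : ∀ σ x, eval q (Nat.pair (encode σ) x) = F σ x := by
    intro σ x; rw [hq]; simp
  -- The length of the oracle string doubles as the stage: at that stage the approximation is
  -- already correct below `n`, and the computation on that segment has halted.
  let R : ℕ → (List ℕ × ℕ) → Prop := fun n p =>
    initSeg (stageChi d p.1.length) n = p.1.take n ∧
      (evaln p.1.length q (Nat.pair (encode (p.1.take n)) p.2)).isSome = true
  have hR : PrimrecRel R := by
    have hl : Primrec fun r : ℕ × (List ℕ × ℕ) => r.2.1.length :=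
      Primrec.list_length.comp (Primrec.fst.comp Primrec.snd)
    have ht : Primrec fun r : ℕ × (List ℕ × ℕ) => r.2.1.take r.1 :=
      Primrec.list_take.comp Primrec.fst (Primrec.fst.comp Primrec.snd)
    refine PrimrecPred.and (Primrec.eq.comp ?_ ht) (Primrec.eq.comp ?_ (Primrec.const true))
    · exact primrec_initSeg_stageChi.comp
        (Primrec.pair (Primrec.pair hl (Primrec.const d)) Primrec.fst)
    · exact Primrec.option_isSome.comp (Nat.Partrec.Code.primrec_evaln.comp
        (Primrec.pair (Primrec.pair hl (Primrec.const q))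
          (Primrec₂.natPair.comp (Primrec.encode.comp ht) (Primrec.snd.comp Primrec.snd))))
  classical
  let G : List ℕ → ℕ → Option ℕ := fun σ x =>
    if ∃ n ∈ List.range (σ.length + 1), R n (σ, x) then some σ.length else none
  have hG : Primrec₂ G := by
    refine Primrec.ite (c := fun p : List ℕ × ℕ => ∃ n ∈ List.range (p.1.length + 1), R n (p.1, p.2)) ?_
      (Primrec.option_some.comp (Primrec.list_length.comp Primrec.fst)) (Primrec.const none)
    exact PrimrecRel.comp
      (PrimrecRel.exists_mem_list hR)
      (Primrec.list_range.comp (Primrec.succ.comp (Primrec.list_length.comp Primrec.fst)))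
      Primrec.id
  obtain ⟨m, hm, hmG⟩ := exists_turingReducible_of_search (chi W) hG.to_comp (fun x => by
    obtain ⟨n, hn⟩ := eF x (f x) (by simp)
    obtain ⟨k, hk⟩ := Nat.Partrec.Code.evaln_complete.1 ((hqF _ _).symm ▸ hn)
    obtain ⟨t, ht⟩ := hd.exists_stage n
    let s := max n (max k t)
    have hns : n ≤ s := le_max_left _ _
    have hks : k ≤ s := (le_max_left _ _).trans (le_max_right _ _)
    have hts : t ≤ s := (le_max_right _ _).trans (le_max_right _ _)
    refine ⟨s, ?_⟩
    have : ∃ n ∈ List.range ((initSeg (chi W) s).length + 1), R n (initSeg (chi W) s, x) := by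
      refine ⟨n, by simpa using Nat.lt_succ_of_le hns, ?_⟩
      simp only [R, length_initSeg, take_initSeg _ hns]
      exact ⟨ht s hts, Option.isSome_iff_exists.2 ⟨_, Nat.Partrec.Code.evaln_mono hks hk⟩⟩
    simp only [G, if_pos this, Option.isSome_some])
  refine ⟨Nat.pair (encode q) (encode d), m, hm, fun c s hs => ?_⟩
  obtain ⟨N, hN⟩ := hmG c
  have hex : ∃ n ∈ List.range ((initSeg (chi W) N).length + 1), R n (initSeg (chi W) N, c) := by
    by_contra hc
    simp only [G, if_neg hc] at hN
    cases hN
  simp only [G, if_pos hex, length_initSeg, Option.some.injEq] at hN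
  obtain ⟨n, hn, hR1, hR2⟩ := hex
  have hnN : n ≤ N := by simpa [Nat.lt_succ_iff] using hn
  simp only [length_initSeg, take_initSeg _ hnN] at hR1 hR2
  have hNs : N ≤ s := hN ▸ hs
  have hseg := hd.initSeg_eq_of_le hNs hR1
  obtain ⟨y, hy⟩ := Option.isSome_iff_exists.1 hR2
  have hys : evaln s q (Nat.pair (encode (initSeg (stageChi d s) n)) c) = some y := by
    rw [hseg]; exact Nat.Partrec.Code.evaln_mono hNs hy
  -- `guess` takes the first convergent segment, which need not be the certified one. All segments
  -- at stage `s` are comparable, so by monotonicity of `F` every convergent one gives the same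
  -- value.
  have huniq : ∀ k z, evaln s q (Nat.pair (encode (initSeg (stageChi d s) k)) c) = some z →
      z = f c := by
    have main : ∀ k z, evaln s q (Nat.pair (encode (initSeg (stageChi d s) k)) c) = some z →
        ∀ l, k ≤ l → z ∈ F (initSeg (stageChi d s) l) c := fun k z hz l hkl =>
      mF _ _ _ _ (initSeg_prefix _ hkl) (hqF _ _ ▸ Nat.Partrec.Code.evaln_sound hz)
    have hyF : y ∈ F (initSeg (chi W) n) c := hqF _ _ ▸ Nat.Partrec.Code.evaln_sound hy
    obtain ⟨n', hn'⟩ := eF c (f c) (by simp)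
    have hyf : y = f c := Part.mem_unique
      (mF _ _ _ _ (initSeg_prefix _ (le_max_left n n')) hyF)
      (mF _ _ _ _ (initSeg_prefix _ (le_max_right n n')) hn')
    intro k z hz
    rw [← hyf]
    exact Part.mem_unique (main k z hz (max k n) (le_max_left _ _))
      (main n y hys (max k n) (le_max_right _ _))
  have hmem : y ∈ (List.range (s + 1)).filterMap fun n => evaln s (ofNat Code (encode q))
      (Nat.pair (encode (initSeg (stageChi (ofNat Code (encode d)) s) n)) c) := by
    rw [List.mem_filterMap]
    exact ⟨n, by simp; lia, by simpa using hys⟩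
  simp only [guess, Nat.unpair_pair]
  cases hl : (List.range (s + 1)).filterMap fun n => evaln s (ofNat Code (encode q))
      (Nat.pair (encode (initSeg (stageChi (ofNat Code (encode d)) s) n)) c) with
  | nil => rw [hl] at hmem; cases hmem
  | cons z l =>
    have hz : z ∈ z :: l := List.mem_cons_self
    rw [← hl, List.mem_filterMap] at hz
    obtain ⟨k, -, hk⟩ := hz
    simpa using huniq k z (by simpa using hk)

/-! ### The dumping construction and its primitive recursiveness. -/

/-- The number of usable elements in the `c`-th column. -/
def columnSize (c : ℕ) : ℕ := (c + 1) * (c + 2) + 1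

/-- The events relevant to column `c`: for `k ≤ c`, the `k`-th event is the enumeration of `k` into
the halting set; the last one is the enumeration of `c` into the domain of `d`. -/
def event (d : Code) (c s k : ℕ) : ℕ :=
  if k ≤ c then stageChi (ofNat Code k) s k else stageChi d s c

/-- The number of events for column `c` that occurred by stage `s`. -/
def eventCount (d : Code) (c s : ℕ) : ℕ := ((List.range (c + 2)).map (event d c s)).sum

/-- Add to `a` the first unused element of column `c` that, according to the string coded by `g`,
is omitted by the set guessed at. -/
def pick (c g : ℕ) (a : List ℕ) : List ℕ :=
  a ++ ((List.range (columnSize c)).filterMap fun j =>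
    if ¬ (∃ i ∈ a, i = j) ∧ (ofNat (List ℕ) g)[Nat.pair c j]? = some 0 then some j
    else none).head?.toList

/-- Apply `pick` for all guesses with index at most `c`. -/
def pickAll (c s : ℕ) (a : List ℕ) : List ℕ :=
  (List.range (c + 1)).foldl (fun a e => pick c (guess e c s) a) a

/-- The elements of column `c` dumped into the first set of the pair by stage `s`. -/
def dumped (d : Code) (c s : ℕ) : List ℕ :=
  Nat.rec [] (fun s a =>
    -- The test is made at `s`, not `s + 1`: the entry of `c` itself still triggers one last dump
    -- before the column freezes.
    if inDom d s c = true ∨ eventCount d c (s + 1) = eventCount d c s then a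
    else pickAll c s a) s

theorem primrec_stageChi : Primrec fun p : (ℕ × Code) × ℕ => stageChi p.1.2 p.1.1 p.2 :=
  Primrec.ite (Primrec.eq.comp primrec_inDom (Primrec.const true)) (Primrec.const 1)
    (Primrec.const 0)

theorem primrec_eventCount (d : Code) : Primrec₂ (eventCount d) := by
  have hsum : Primrec fun l : List ℕ => l.sum :=
    (Primrec.list_foldr (g := fun _ : List ℕ => 0) (h := fun _ (p : ℕ × ℕ) => p.1 + p.2) Primrec.id
      (Primrec.const 0) (Primrec.nat_add.comp (Primrec.fst.comp Primrec.snd)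
        (Primrec.snd.comp Primrec.snd))).of_eq fun l => by simp [List.sum]
  refine hsum.comp (Primrec.list_map (Primrec.list_range.comp
    (Primrec.succ.comp (Primrec.succ.comp Primrec.fst))) ?_)
  have hs : Primrec fun q : (ℕ × ℕ) × ℕ => q.1.2 := Primrec.snd.comp Primrec.fst
  have hc : Primrec fun q : (ℕ × ℕ) × ℕ => q.1.1 := Primrec.fst.comp Primrec.fst
  refine Primrec.ite (Primrec.nat_le.comp Primrec.snd hc) ?_ ?_
  · exact primrec_stageChi.comp (Primrec.pair (Primrec.pair hs
      ((Primrec.ofNat Code).comp Primrec.snd)) Primrec.snd)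
  · exact primrec_stageChi.comp (Primrec.pair (Primrec.pair hs (Primrec.const d)) hc)

theorem primrec_columnSize : Primrec columnSize :=
  Primrec.succ.comp (Primrec.nat_mul.comp Primrec.succ (Primrec.succ.comp Primrec.succ))

theorem primrecRel_mem : PrimrecRel fun (a : List ℕ) (j : ℕ) => ∃ i ∈ a, i = j :=
  PrimrecRel.exists_mem_list Primrec.eq

theorem primrec_pick : Primrec fun p : (ℕ × ℕ) × List ℕ => pick p.1.1 p.1.2 p.2 := by
  refine Primrec.list_append.comp Primrec.snd (Primrec.optionToList.comp (Primrec.list_head?.comp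
    (Primrec.listFilterMap (Primrec.list_range.comp (primrec_columnSize.comp
      (Primrec.fst.comp Primrec.fst))) ?_)))
  refine Primrec.ite (PrimrecPred.and (PrimrecPred.not ?_) ?_)
    (Primrec.option_some.comp Primrec.snd) (Primrec.const none)
  · exact primrecRel_mem.comp (Primrec.snd.comp Primrec.fst) Primrec.snd
  · refine Primrec.eq.comp (Primrec.list_getElem?.comp ((Primrec.ofNat _).comp ?_)
      (Primrec₂.natPair.comp ?_ Primrec.snd)) (Primrec.const (some 0))
    · exact Primrec.snd.comp (Primrec.fst.comp Primrec.fst)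
    · exact Primrec.fst.comp (Primrec.fst.comp Primrec.fst)

theorem primrec_pickAll : Primrec fun p : (ℕ × ℕ) × List ℕ => pickAll p.1.1 p.1.2 p.2 := by
  refine Primrec.list_foldl (h := fun (p : (ℕ × ℕ) × List ℕ) (q : List ℕ × ℕ) =>
    pick p.1.1 (guess q.2 p.1.1 p.1.2) q.1) (Primrec.list_range.comp (Primrec.succ.comp
      (Primrec.fst.comp Primrec.fst))) Primrec.snd ?_
  have hc : Primrec fun r : ((ℕ × ℕ) × List ℕ) × (List ℕ × ℕ) => r.1.1.1 :=
    Primrec.fst.comp (Primrec.fst.comp Primrec.fst)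
  have hs : Primrec fun r : ((ℕ × ℕ) × List ℕ) × (List ℕ × ℕ) => r.1.1.2 :=
    Primrec.snd.comp (Primrec.fst.comp Primrec.fst)
  exact primrec_pick.comp (Primrec.pair (Primrec.pair hc (primrec_guess.comp
    (Primrec.pair (Primrec.pair (Primrec.snd.comp Primrec.snd) hc) hs)))
    (Primrec.fst.comp Primrec.snd))

theorem primrec_dumped (d : Code) : Primrec₂ (dumped d) := by
  refine (Primrec.nat_rec (f := fun _ : ℕ => ([] : List ℕ)) (g := fun c (p : ℕ × List ℕ) =>
    if inDom d p.1 c = true ∨ eventCount d c (p.1 + 1) = eventCount d c p.1 then p.2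
    else pickAll c p.1 p.2) (Primrec.const []) ?_)
  have hs : Primrec fun q : ℕ × (ℕ × List ℕ) => q.2.1 := Primrec.fst.comp Primrec.snd
  have ha : Primrec fun q : ℕ × (ℕ × List ℕ) => q.2.2 := Primrec.snd.comp Primrec.snd
  have h1 : Primrec fun q : ℕ × (ℕ × List ℕ) => eventCount d q.1 (q.2.1 + 1) :=
    (primrec_eventCount d).comp Primrec.fst (Primrec.succ.comp hs)
  have h0 : Primrec fun q : ℕ × (ℕ × List ℕ) => eventCount d q.1 q.2.1 :=
    (primrec_eventCount d).comp Primrec.fst hs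
  have hpick : Primrec fun q : ℕ × (ℕ × List ℕ) => pickAll q.1 q.2.1 q.2.2 :=
    primrec_pickAll.comp (g := fun q : ℕ × (ℕ × List ℕ) => ((q.1, q.2.1), q.2.2))
      (Primrec.pair (Primrec.pair Primrec.fst hs) ha)
  have heq : PrimrecPred fun q : ℕ × (ℕ × List ℕ) =>
      eventCount d q.1 (q.2.1 + 1) = eventCount d q.1 q.2.1 :=
    Primrec.eq.comp h1 h0
  refine Primrec.ite (PrimrecPred.or ?_ heq) ha hpick
  exact Primrec.eq.comp (primrec_inDom.comp
      (Primrec.pair (Primrec.pair hs (Primrec.const d)) Primrec.fst)) (Primrec.const true)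

/-! ### Counting events and dumped elements. -/

theorem stageChi_mono {d : Code} {s t i : ℕ} (hst : s ≤ t) : stageChi d s i ≤ stageChi d t i := by
  unfold stageChi
  split_ifs with h1 h2 <;> simp
  exact h2 (inDom_mono hst h1)

theorem stageChi_le_one (d : Code) (s i : ℕ) : stageChi d s i ≤ 1 := by
  unfold stageChi; split_ifs <;> simp

theorem event_mono {d : Code} {c s t k : ℕ} (hst : s ≤ t) : event d c s k ≤ event d c t k := by
  unfold event; split_ifs <;> exact stageChi_mono hst

theorem eventCount_mono {d : Code} {c s t : ℕ} (hst : s ≤ t) :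
    eventCount d c s ≤ eventCount d c t :=
  List.sum_le_sum fun _ _ => event_mono hst

theorem eventCount_le (d : Code) (c s : ℕ) : eventCount d c s ≤ c + 2 := by
  have := List.sum_le_card_nsmul ((List.range (c + 2)).map (event d c s)) 1 (by
    intro x hx
    obtain ⟨k, -, rfl⟩ := List.mem_map.1 hx
    unfold event; split_ifs <;> exact stageChi_le_one _ _ _)
  simpa [eventCount] using this

theorem eventCount_lt {d : Code} {c s t k : ℕ} (hst : s ≤ t) (hk : k < c + 2)
    (h : event d c s k < event d c t k) : eventCount d c s < eventCount d c t :=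
  List.sum_lt_sum _ _ (fun _ _ => event_mono hst) ⟨k, List.mem_range.2 hk, h⟩

theorem dumped_succ (d : Code) (c s : ℕ) : dumped d c (s + 1) =
    if inDom d s c = true ∨ eventCount d c (s + 1) = eventCount d c s then dumped d c s
    else pickAll c s (dumped d c s) := rfl

theorem subset_pick (c g : ℕ) (a : List ℕ) : a ⊆ pick c g a := List.subset_append_left _ _

theorem length_pick_le (c g : ℕ) (a : List ℕ) : (pick c g a).length ≤ a.length + 1 := by
  have h : ∀ o : Option ℕ, o.toList.length ≤ 1 := by rintro (_ | _) <;> simp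
  simp [pick, h]

/-- The element chosen may differ from `j`; what matters is that some member of the resulting list
is omitted according to the guess. -/
theorem exists_mem_pick {c g j : ℕ} {a : List ℕ} (hj : j < columnSize c)
    (hja : j ∉ a) (hg : (ofNat (List ℕ) g)[Nat.pair c j]? = some 0) :
    ∃ i ∈ pick c g a, (ofNat (List ℕ) g)[Nat.pair c i]? = some 0 := by
  set l := (List.range (columnSize c)).filterMap fun j =>
    if ¬ (∃ i ∈ a, i = j) ∧ (ofNat (List ℕ) g)[Nat.pair c j]? = some 0 then some j
    else none with hl
  have hmem : j ∈ l := by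
    rw [hl, List.mem_filterMap]
    refine ⟨j, List.mem_range.2 hj, if_pos ⟨?_, hg⟩⟩
    rintro ⟨i, hi, rfl⟩
    exact hja hi
  have hpick : pick c g a = a ++ l.head?.toList := rfl
  cases hc : l with
  | nil => rw [hc] at hmem; cases hmem
  | cons i l' =>
    refine ⟨i, by simp [hpick, hc], ?_⟩
    have hi : i ∈ l := by simp [hc]
    rw [hl, List.mem_filterMap] at hi
    obtain ⟨i', -, hi'⟩ := hi
    split_ifs at hi' with h
    cases hi'
    exact h.2

/-- Later picks only enlarge the list, so what `exists_mem_pick` gives for one index survives the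
whole round, and each index costs at most one element. -/
theorem foldl_pick_properties (c s : ℕ) (L a : List ℕ) :
    let r := L.foldl (fun a e => pick c (guess e c s) a) a
    a ⊆ r ∧ r.length ≤ a.length + L.length ∧
      ∀ e ∈ L, ∀ j < columnSize c, j ∉ r → (ofNat (List ℕ) (guess e c s))[Nat.pair c j]? = some 0 →
        ∃ i ∈ r, (ofNat (List ℕ) (guess e c s))[Nat.pair c i]? = some 0 := by
  induction L generalizing a with
  | nil => simp
  | cons e L ih =>
    obtain ⟨h1, h2, h3⟩ := ih (pick c (guess e c s) a)
    refine ⟨List.Subset.trans (subset_pick _ _ _) h1, ?_, ?_⟩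
    · have := length_pick_le c (guess e c s) a
      simp only [List.foldl_cons, List.length_cons] at h2 ⊢
      lia
    · intro e' he' j hj hjr hg
      rcases List.mem_cons.1 he' with rfl | he'
      · obtain ⟨i, hi, hig⟩ := exists_mem_pick hj
          (fun h => hjr (h1 (subset_pick _ _ _ h))) hg
        exact ⟨i, h1 hi, hig⟩
      · exact h3 e' he' j hj hjr hg

theorem dumped_mono {d : Code} {c s t : ℕ} (hst : s ≤ t) : dumped d c s ⊆ dumped d c t := by
  induction t, hst using Nat.le_induction with
  | base => exact List.Subset.refl _
  | succ t _ ih =>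
    rw [dumped_succ]
    split_ifs
    · exact ih
    · exact List.Subset.trans ih (foldl_pick_properties c t (List.range (c + 1)) _).1

theorem dumped_eq_of_inDom {d : Code} {c s t : ℕ} (hst : s ≤ t) (h : inDom d s c) :
    dumped d c t = dumped d c s := by
  induction t, hst using Nat.le_induction with
  | base => rfl
  | succ t hst ih => rw [dumped_succ, if_pos (Or.inl (inDom_mono hst h)), ih]

/-- The list grows only when the event count rises, and then by at most one element for each of the
`c + 1` indices. -/
theorem length_dumped_le (d : Code) (c s : ℕ) :
    (dumped d c s).length ≤ (c + 1) * eventCount d c s := by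
  induction s with
  | zero => simp [dumped]
  | succ s ih =>
    have hmono : eventCount d c s ≤ eventCount d c (s + 1) := eventCount_mono (Nat.le_succ s)
    rw [dumped_succ]
    split_ifs with h
    · exact ih.trans (Nat.mul_le_mul_left _ hmono)
    · have hlt : eventCount d c s + 1 ≤ eventCount d c (s + 1) := by
        have : eventCount d c (s + 1) ≠ eventCount d c s := fun hc => h (Or.inr hc)
        lia
      have h2 := (foldl_pick_properties c s (List.range (c + 1)) (dumped d c s)).2.1
      rw [List.length_range] at h2
      calc _ ≤ (dumped d c s).length + (c + 1) := h2
        _ ≤ (c + 1) * (eventCount d c s + 1) := by rw [Nat.mul_succ]; lia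
        _ ≤ _ := Nat.mul_le_mul_left _ hlt

/-- Otherwise a single stage would have dumped the whole block, which is one larger than the bound
`(c + 1) * (c + 2)` on the dumped elements. -/
theorem exists_not_dumped (d : Code) (c : ℕ) : ∃ j < columnSize c, ∀ s, j ∉ dumped d c s := by
  by_contra! hc
  have key : ∀ n ≤ columnSize c, ∃ s, ∀ j < n, j ∈ dumped d c s := by
    intro n
    induction n with
    | zero => exact fun _ => ⟨0, by simp⟩
    | succ n ih =>
      intro hn
      obtain ⟨s, hs⟩ := ih (by lia)
      obtain ⟨t, ht⟩ := hc n (by lia)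
      refine ⟨max s t, fun j hj => ?_⟩
      rcases Nat.lt_succ_iff_lt_or_eq.1 hj with hj | rfl
      · exact dumped_mono (le_max_left _ _) (hs j hj)
      · exact dumped_mono (le_max_right _ _) ht
  obtain ⟨s, hs⟩ := key _ le_rfl
  have h1 : (List.range (columnSize c)).length ≤ (dumped d c s).length :=
    (List.nodup_range.subperm fun j hj => hs j (List.mem_range.1 hj)).length_le
  have h2 := length_dumped_le d c s
  have h3 := Nat.mul_le_mul_left (c + 1) (eventCount_le d c s)
  rw [List.length_range, columnSize] at h1
  lia

/-! ### The pair of c.e. sets. -/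

/-- The first set of the pair: the dumped elements, and all surplus elements of the columns. -/
def dumpSet (d : Code) : Set ℕ :=
  {p | ∃ s, columnSize p.unpair.1 ≤ p.unpair.2 ∨ ∃ i ∈ dumped d p.unpair.1 s, i = p.unpair.2}

/-- The second set of the pair: when `c` enters the domain of `d`, all elements of column `c` that
are not in the first set are enumerated. -/
def codeSet (d : Code) : Set ℕ :=
  {p | ∃ s, inDom d s p.unpair.1 = true ∧ p.unpair.2 < columnSize p.unpair.1 ∧
    ¬ ∃ i ∈ dumped d p.unpair.1 s, i = p.unpair.2}

theorem isCE_of_primrecRel {R : ℕ → ℕ → Prop} (hR : PrimrecRel R) : IsCE {x | ∃ s, R x s} := by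
  classical
  have h : Partrec fun x : ℕ => Nat.rfind fun s => Part.some (decide (R x s)) :=
    Partrec.rfind (PrimrecPred.decide hR).to_comp.partrec
  refine h.dom_re.of_eq fun x => ?_
  refine Nat.rfind_dom'.trans ?_
  simp

theorem primrec_column (d : Code) :
    Primrec fun q : ℕ × ℕ => dumped d q.1.unpair.1 q.2 :=
  (primrec_dumped d).comp (Primrec.fst.comp (Primrec.unpair.comp Primrec.fst)) Primrec.snd

theorem primrecPred_dumped (d : Code) : PrimrecPred fun q : ℕ × ℕ =>
    ∃ i ∈ dumped d q.1.unpair.1 q.2, i = q.1.unpair.2 :=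
  primrecRel_mem.comp (primrec_column d) (Primrec.snd.comp (Primrec.unpair.comp Primrec.fst))

theorem isCE_dumpSet (d : Code) : IsCE (dumpSet d) := by
  refine isCE_of_primrecRel (R := fun p s => columnSize p.unpair.1 ≤ p.unpair.2 ∨
    ∃ i ∈ dumped d p.unpair.1 s, i = p.unpair.2) (PrimrecPred.or ?_ (primrecPred_dumped d))
  exact Primrec.nat_le.comp
    (primrec_columnSize.comp (Primrec.fst.comp (Primrec.unpair.comp Primrec.fst)))
    (Primrec.snd.comp (Primrec.unpair.comp Primrec.fst))

theorem isCE_codeSet (d : Code) : IsCE (codeSet d) := by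
  refine isCE_of_primrecRel (R := fun p s => inDom d s p.unpair.1 = true ∧
    p.unpair.2 < columnSize p.unpair.1 ∧ ¬ ∃ i ∈ dumped d p.unpair.1 s, i = p.unpair.2)
    (PrimrecPred.and ?_ (PrimrecPred.and ?_ (PrimrecPred.not (primrecPred_dumped d))))
  · exact Primrec.eq.comp (primrec_inDom.comp (Primrec.pair (Primrec.pair Primrec.snd
      (Primrec.const d)) (Primrec.fst.comp (Primrec.unpair.comp Primrec.fst)))) (Primrec.const true)
  · exact Primrec.nat_lt.comp (Primrec.snd.comp (Primrec.unpair.comp Primrec.fst))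
      (primrec_columnSize.comp (Primrec.fst.comp (Primrec.unpair.comp Primrec.fst)))

theorem pair_mem_dumpSet {d : Code} {c j s : ℕ} (h : j ∈ dumped d c s) :
    Nat.pair c j ∈ dumpSet d :=
  ⟨s, Or.inr ⟨j, by simpa using h, by simp⟩⟩

/-- Once `c` is enumerated its column is frozen, so an element coded into the second set can no
longer be dumped. -/
theorem dumpSet_inter_codeSet (d : Code) : dumpSet d ∩ codeSet d = ∅ := by
  refine Set.eq_empty_iff_forall_notMem.2 ?_
  rintro p ⟨⟨s, hs⟩, t, ht, hlt, hnd⟩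
  rcases hs with hs | ⟨i, hi, rfl⟩
  · lia
  · refine hnd ⟨_, ?_, rfl⟩
    rcases le_total s t with h | h
    · exact dumped_mono h hi
    · rwa [dumped_eq_of_inDom h ht] at hi

theorem infinite_compl_union {d : Code} {C : Set ℕ} (hd : Enumerates d C) (hC : Cᶜ.Infinite) :
    (dumpSet d ∪ codeSet d)ᶜ.Infinite := by
  choose j hj hjd using exists_not_dumped d
  refine (hC.image (f := fun c => Nat.pair c (j c)) ?_).mono ?_
  · intro a _ b _ hab
    exact (Nat.pair_eq_pair.1 hab).1
  · rintro _ ⟨c, hc, rfl⟩ (⟨s, hs⟩ | ⟨s, hs, -⟩)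
    · simp only [Nat.unpair_pair] at hs
      rcases hs with hs | ⟨i, hi, rfl⟩
      · exact absurd (hj c) (by lia)
      · exact hjd c s hi
    · exact hc ((hd c).2 ⟨s, by simpa using hs⟩)

/-! ### Computing the halting set from a separator. -/

theorem mem_haltingSet_iff {k : ℕ} : k ∈ haltingSet ↔ ∃ s, inDom (ofNat Code k) s k :=
  exists_inDom_iff.symm

theorem eq_of_initSeg_getElem? {o : ℕ → ℕ} {n i v : ℕ} (h : (initSeg o n)[i]? = some v) :
    v = o i := by
  have hi : i < n := by simpa using (List.getElem?_eq_some_iff.1 h).1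
  rw [initSeg_getElem? o hi] at h
  exact (Option.some.inj h).symm

/-- Once the guess about column `c` has settled and the column is seen to contain an element that
the separator omits and that is not yet in `codeSet d`, no further event occurs. -/
theorem halting_settled {d : Code} {Z : Set ℕ} (hA : dumpSet d ⊆ Z) {e c j t : ℕ}
    (he : e ≤ c) (hj : j < columnSize c) (hjZ : Nat.pair c j ∉ Z)
    (hguess : ∀ s, t ≤ s →
      guess e c s = encode (initSeg (chi Z) (Nat.pair c (columnSize c))))
    (hB : ¬ (inDom d t c = true ∧ ¬ ∃ i ∈ dumped d c t, i = j)) {k : ℕ} (hk : k ≤ c) :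
    stageChi (ofNat Code k) t k = chi haltingSet k := by
  have hjd : ∀ s, j ∉ dumped d c s := fun s hs => hjZ (hA (pair_mem_dumpSet hs))
  have htc : ¬ inDom d t c = true := fun h => hB ⟨h, by rintro ⟨i, hi, rfl⟩; exact hjd t hi⟩
  have stable : ∀ s, t ≤ s → ¬ inDom d s c = true ∧ eventCount d c s = eventCount d c t := by
    intro s hs
    induction s, hs using Nat.le_induction with
    | base => exact ⟨htc, rfl⟩
    | succ s hs ih =>
      obtain ⟨hsc, hcount⟩ := ih
      have heq : eventCount d c (s + 1) = eventCount d c s := by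
        by_contra hne
        have hdump : dumped d c (s + 1) = pickAll c s (dumped d c s) := by
          rw [dumped_succ, if_neg (not_or.2 ⟨hsc, hne⟩)]
        have hlook : (ofNat (List ℕ) (guess e c s))[Nat.pair c j]? = some 0 := by
          rw [hguess s hs, ofNat_encode, initSeg_getElem? _ (Nat.pair_lt_pair_right c hj),
            chi_eq_zero.2 hjZ]
        obtain ⟨i, hi, hig⟩ := (foldl_pick_properties c s (List.range (c + 1)) (dumped d c s)).2.2
          e (List.mem_range.2 (Nat.lt_succ_of_le he)) j hj
          (fun h => hjd (s + 1) (hdump ▸ h)) hlook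
        rw [hguess s hs, ofNat_encode] at hig
        -- The contradiction: `i` was dumped, hence lies in `Z`, while the settled guess, which is
        -- correct, says that `Z` omits it.
        refine chi_eq_zero.1 (eq_of_initSeg_getElem? hig).symm (hA (pair_mem_dumpSet (s := s + 1) ?_))
        rw [hdump]
        exact hi
      refine ⟨fun hin => ?_, heq.trans hcount⟩
      refine absurd heq (ne_of_gt (eventCount_lt (Nat.le_succ s) (Nat.lt_succ_self (c + 1)) ?_))
      simp [event, stageChi, hsc, hin]
  by_cases hkK : k ∈ haltingSet
  · rw [chi_eq_one.2 hkK]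
    obtain ⟨s, hs⟩ := mem_haltingSet_iff.1 hkK
    have hs' := inDom_mono (le_max_left s t) hs
    by_contra hne
    have hkt : ¬ inDom (ofNat Code k) t k = true := fun h => hne (by simp [stageChi, h])
    refine absurd (stable (max s t) (le_max_right _ _)).2
      (ne_of_gt (eventCount_lt (k := k) (le_max_right _ _) (by lia) ?_))
    simp [event, hk, stageChi, hkt, hs']
  · rw [chi_eq_zero.2 hkK]
    have : ¬ inDom (ofNat Code k) t k = true := fun h => hkK (mem_haltingSet_iff.2 ⟨t, h⟩)
    simp [stageChi, this]

theorem columnSize_mono : Monotone columnSize := fun a b h => by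
  unfold columnSize; gcongr

/-- A separator of c.e. degree that omits infinitely many elements outside `codeSet d` computes the
halting set. -/
theorem haltingSet_turingReducible {d dW : Code} {Z W : Set ℕ}
    (hZ : Z ∈ separatingClass (dumpSet d) (codeSet d)) (hW : Enumerates dW W)
    (hZW : TuringReducible (chi Z) (chi W)) (hWZ : TuringReducible (chi W) (chi Z))
    (hinf : (Zᶜ \ codeSet d).Infinite) : TuringReducible (chi haltingSet) (chi Z) := by
  -- This length covers the whole block of column `c`, since pairing is increasing in its second
  -- argument.
  let f : ℕ → ℕ := fun c => encode (initSeg (chi Z) (Nat.pair c (columnSize c)))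
  have hf : TuringReducible f (chi Z) := by
    refine turingReducible_of_search (F := fun σ c =>
      if σ.length = Nat.pair c (columnSize c) then some (encode σ) else none) ?_ ?_ ?_
    · refine Primrec.to_comp (Primrec.ite (Primrec.eq.comp (Primrec.list_length.comp Primrec.fst)
        (Primrec₂.natPair.comp Primrec.snd (primrec_columnSize.comp Primrec.snd)))
        (Primrec.option_some.comp (Primrec.encode.comp Primrec.fst)) (Primrec.const none))
    · exact fun c => ⟨Nat.pair c (columnSize c), by simp⟩
    · intro c n y h
      split_ifs at h with hn
      rw [length_initSeg] at hn
      subst hn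
      exact (Option.some.inj h).symm
  obtain ⟨e, m, hm, hguess⟩ := exists_guess_modulus hW (hf.trans hZW)
  -- Membership in `Z` and the modulus of the column are packed into one oracle, so the search only
  -- has to read the last entry of a segment.
  let o : ℕ → ℕ := fun p => Nat.pair (chi Z p) (m p.unpair.1)
  have ho : TuringReducible o (chi Z) := by
    rw [TuringReducible, RecursiveIn.iff_nat]
    refine (Nat.RecursiveIn.pair (Nat.RecursiveIn.oracle _ (Set.mem_singleton _))
      (Nat.RecursiveIn.comp (RecursiveIn.iff_nat.1 (hm.trans hWZ))
        Nat.RecursiveIn.left)).of_eq fun p => ?_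
    have h1 : (Part.some p.unpair.1 >>= (m : ℕ →. ℕ)) = Part.some (m p.unpair.1) :=
      Part.bind_some _ _
    simp [Seq.seq, o, h1]
  refine TuringReducible.trans ?_ ho
  -- With `p` the last position of the segment: its column is at least `k` and `e`, `p` lies in the
  -- block and outside `Z`, and `p` is not seen in `codeSet d` at the modulus stage. A later entry
  -- into `codeSet d` is harmless, since `halting_settled` excludes it.
  let cond : (List ℕ × ℕ) × ℕ → Prop := fun q =>
    q.1.2 ≤ (q.1.1.length - 1).unpair.1 ∧ e ≤ (q.1.1.length - 1).unpair.1 ∧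
      (q.1.1.length - 1).unpair.2 < columnSize (q.1.1.length - 1).unpair.1 ∧
      q.2.unpair.1 = 0 ∧
      ¬ (inDom d q.2.unpair.2 (q.1.1.length - 1).unpair.1 = true ∧
        ¬ ∃ i ∈ dumped d (q.1.1.length - 1).unpair.1 q.2.unpair.2,
          i = (q.1.1.length - 1).unpair.2)
  have hcond : PrimrecPred cond := by
    have hp : Primrec fun q : (List ℕ × ℕ) × ℕ => q.1.1.length - 1 :=
      Primrec.nat_sub.comp (Primrec.list_length.comp (Primrec.fst.comp Primrec.fst))
        (Primrec.const 1)
    have hc : Primrec fun q : (List ℕ × ℕ) × ℕ => (q.1.1.length - 1).unpair.1 :=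
      Primrec.fst.comp (Primrec.unpair.comp hp)
    have hj : Primrec fun q : (List ℕ × ℕ) × ℕ => (q.1.1.length - 1).unpair.2 :=
      Primrec.snd.comp (Primrec.unpair.comp hp)
    have ht : Primrec fun q : (List ℕ × ℕ) × ℕ => q.2.unpair.2 :=
      Primrec.snd.comp (Primrec.unpair.comp Primrec.snd)
    have hdump : Primrec fun q : (List ℕ × ℕ) × ℕ =>
        dumped d (q.1.1.length - 1).unpair.1 q.2.unpair.2 := (primrec_dumped d).comp hc ht
    refine PrimrecPred.and (Primrec.nat_le.comp (Primrec.snd.comp Primrec.fst) hc)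
      (PrimrecPred.and (Primrec.nat_le.comp (Primrec.const e) hc)
      (PrimrecPred.and (Primrec.nat_lt.comp hj (primrec_columnSize.comp hc))
      (PrimrecPred.and (Primrec.eq.comp (Primrec.fst.comp (Primrec.unpair.comp Primrec.snd))
        (Primrec.const 0)) (PrimrecPred.not (PrimrecPred.and ?_ (PrimrecPred.not ?_))))))
    · exact Primrec.eq.comp (primrec_inDom.comp (Primrec.pair (Primrec.pair ht
        (Primrec.const d)) hc)) (Primrec.const true)
    · exact primrecRel_mem.comp hdump hj
  classical
  refine turingReducible_of_search (F := fun σ k => σ[σ.length - 1]?.bind fun v =>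
    if cond ((σ, k), v) then some (stageChi (ofNat Code k) v.unpair.2 k) else none) ?_ ?_ ?_
  · refine Primrec.to_comp (Primrec.option_bind (Primrec.list_getElem?.comp Primrec.fst
      (Primrec.nat_sub.comp (Primrec.list_length.comp Primrec.fst) (Primrec.const 1))) ?_)
    refine Primrec.ite hcond (Primrec.option_some.comp ?_) (Primrec.const none)
    exact primrec_stageChi.comp (Primrec.pair (Primrec.pair
      (Primrec.snd.comp (Primrec.unpair.comp Primrec.snd))
      ((Primrec.ofNat Code).comp (Primrec.snd.comp Primrec.fst))) (Primrec.snd.comp Primrec.fst))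
  · intro k
    let M := max k e
    -- Every block element of a column before `M` is below this bound, and points beyond the blocks
    -- lie in `Z`, so `p` falls into column `M` or later.
    obtain ⟨p, ⟨hpZ, hpB⟩, hp⟩ := hinf.exists_gt (Nat.pair M (columnSize M))
    have hsize : p.unpair.2 < columnSize p.unpair.1 := by
      by_contra hc
      exact hpZ (hZ.1 ⟨0, Or.inl (not_lt.1 hc)⟩)
    have hMp : M ≤ p.unpair.1 := by
      by_contra! hc
      have h1 : p.unpair.2 < columnSize M := hsize.trans_le (columnSize_mono hc.le)
      have h2 : Nat.pair p.unpair.1 p.unpair.2 < Nat.pair M (columnSize M) :=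
        (Nat.pair_lt_pair_left _ hc).trans (Nat.pair_lt_pair_right _ h1)
      rw [Nat.pair_unpair] at h2
      lia
    refine ⟨p + 1, ?_⟩
    have hc : cond ((initSeg o (p + 1), k), o p) := by
      simp only [cond, length_initSeg, Nat.add_sub_cancel, o, Nat.unpair_pair]
      refine ⟨(le_max_left _ _).trans hMp, (le_max_right _ _).trans hMp, hsize,
        chi_eq_zero.2 hpZ, fun h => hpB ⟨_, h.1, hsize, h.2⟩⟩
    have hlast : (initSeg o (p + 1))[(initSeg o (p + 1)).length - 1]? = some (o p) := by
      rw [length_initSeg]; exact initSeg_getElem? o (Nat.lt_succ_self p)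
    rw [hlast, Option.bind_some, if_pos hc]
    rfl
  · intro k n y h
    obtain ⟨v, hv, hy⟩ := Option.bind_eq_some_iff.1 h
    split_ifs at hy with hc
    have hvo := eq_of_initSeg_getElem? hv
    simp only [length_initSeg] at hvo
    simp only [cond, length_initSeg] at hc
    rw [← Option.some.inj hy]
    obtain ⟨hk, he, hj, hz, hB⟩ := hc
    rw [hvo] at hz hB ⊢
    simp only [o, Nat.unpair_pair] at hz hB ⊢
    refine halting_settled hZ.1 he hj ?_ (fun s hs => hguess _ s hs) hB hk
    rw [Nat.pair_unpair]
    exact chi_eq_zero.1 hz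

/-! ### Degree computations. -/

theorem deg_eq_iff {X Y : Set ℕ} : deg X = deg Y ↔
    TuringReducible (chi X) (chi Y) ∧ TuringReducible (chi Y) (chi X) :=
  Quotient.eq''

/-- A many-one reduction: `x` is sent to a program that ignores its input and runs the enumeration
of `W` on `x`. -/
theorem turingReducible_haltingSet {W : Set ℕ} (hW : IsCE W) :
    TuringReducible (chi W) (chi haltingSet) := by
  obtain ⟨d, hd⟩ := hW.exists_enumerates
  let h : ℕ → ℕ := fun x => encode (Code.comp d (Code.const x))
  have hh : Primrec h := Primrec.encode.comp (Nat.Partrec.Code.primrec₂_comp.comp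
    (Primrec.const d) Nat.Partrec.Code.primrec_const)
  have hmem : ∀ x, x ∈ W ↔ h x ∈ haltingSet := by
    intro x
    rw [hd x, exists_inDom_iff]
    have : eval (Code.comp d (Code.const x)) (h x) = eval d x := by
      change (eval (Code.const x) (h x)).bind (eval d) = _
      rw [Nat.Partrec.Code.eval_const]
      exact Part.bind_some _ _
    simp [haltingSet, h, ← this]
  refine turingReducible_of_search (F := fun σ x => σ[h x]?)
    (Computable.list_getElem?.comp Computable.fst (hh.to_comp.comp Computable.snd)) ?_ ?_
  · exact fun x => ⟨h x + 1, by rw [initSeg_getElem? _ (Nat.lt_succ_self _)]; rfl⟩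
  · intro x n y hy
    rw [eq_of_initSeg_getElem? hy]
    exact chi_congr (hmem x).symm

theorem chi_compl_turingReducible (X : Set ℕ) : TuringReducible (chi Xᶜ) (chi X) := by
  refine turingReducible_of_search (F := fun σ x => (σ[x]?).map fun v => 1 - v) ?_ ?_ ?_
  · exact (Primrec.option_map Primrec.list_getElem?
      (Primrec.nat_sub.comp (Primrec.const 1) Primrec.snd).to₂).to_comp
  · exact fun x => ⟨x + 1, by rw [initSeg_getElem? _ (Nat.lt_succ_self _)]; rfl⟩
  · intro x n y hy
    obtain ⟨v, hv, rfl⟩ := Option.map_eq_some_iff.1 hy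
    rw [eq_of_initSeg_getElem? hv]
    by_cases hx : x ∈ X <;> simp [chi, hx]

theorem deg_compl (X : Set ℕ) : deg Xᶜ = deg X :=
  deg_eq_iff.2 ⟨chi_compl_turingReducible X, by
    simpa using chi_compl_turingReducible Xᶜ⟩

theorem turingReducible_of_eventually_eq {X Y : Set ℕ} {N : ℕ}
    (h : ∀ x, N ≤ x → (x ∈ X ↔ x ∈ Y)) : TuringReducible (chi X) (chi Y) := by
  refine turingReducible_of_search
    (F := fun σ x => if x < N then (initSeg (chi X) N)[x]? else σ[x]?) ?_ ?_ ?_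
  · exact (Primrec.ite (Primrec.nat_lt.comp Primrec.snd (Primrec.const N))
      (Primrec.list_getElem?.comp (Primrec.const _) Primrec.snd) Primrec.list_getElem?).to_comp
  · intro x
    refine ⟨x + 1, ?_⟩
    split_ifs with hx
    · rw [initSeg_getElem? _ hx]; rfl
    · rw [initSeg_getElem? _ (Nat.lt_succ_self _)]; rfl
  · intro x n y hy
    split_ifs at hy with hx
    · exact eq_of_initSeg_getElem? hy
    · rw [eq_of_initSeg_getElem? hy]
      exact chi_congr (h x (not_lt.1 hx)).symm

/-- From `C`: if `c ∉ C`, its column misses `codeSet d`; otherwise wait until `c` appears and read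
the frozen list. From `codeSet d`: `c ∈ C` exactly when the block of `c` meets it, because a
survivor always remains to be enumerated. -/
theorem deg_codeSet {d : Code} {C : Set ℕ} (hd : Enumerates d C) : deg (codeSet d) = deg C := by
  refine deg_eq_iff.2 ⟨?_, ?_⟩
  · let R : (List ℕ × ℕ) → Prop := fun q => q.2.unpair.2 < columnSize q.2.unpair.1 ∧
      ¬ ∃ i ∈ dumped d q.2.unpair.1 q.1.length, i = q.2.unpair.2
    have hc : Primrec fun q : List ℕ × ℕ => q.2.unpair.1 :=
      Primrec.fst.comp (Primrec.unpair.comp Primrec.snd)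
    have hj : Primrec fun q : List ℕ × ℕ => q.2.unpair.2 :=
      Primrec.snd.comp (Primrec.unpair.comp Primrec.snd)
    have hl : Primrec fun q : List ℕ × ℕ => q.1.length := Primrec.list_length.comp Primrec.fst
    have hdump : Primrec fun q : List ℕ × ℕ => dumped d q.2.unpair.1 q.1.length :=
      (primrec_dumped d).comp hc hl
    have hR : PrimrecPred R := PrimrecPred.and (Primrec.nat_lt.comp hj (primrec_columnSize.comp hc))
      (PrimrecPred.not (primrecRel_mem.comp hdump hj))
    classical
    refine turingReducible_of_search (F := fun σ p =>
      if σ[p.unpair.1]? = some 0 then some 0 else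
      if σ[p.unpair.1]? = some 1 ∧ inDom d σ.length p.unpair.1 = true then
        (if R (σ, p) then some 1 else some 0)
      else none) ?_ ?_ ?_
    · have hget : Primrec fun q : List ℕ × ℕ => q.1[q.2.unpair.1]? :=
        Primrec.list_getElem?.comp Primrec.fst hc
      refine Primrec.to_comp (Primrec.ite (Primrec.eq.comp hget (Primrec.const _))
        (Primrec.const _) (Primrec.ite (PrimrecPred.and (Primrec.eq.comp hget (Primrec.const _))
          (Primrec.eq.comp (primrec_inDom.comp (Primrec.pair (Primrec.pair hl
            (Primrec.const d)) hc)) (Primrec.const true)))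
          (Primrec.ite hR (Primrec.const _) (Primrec.const _)) (Primrec.const _)))
    · intro p
      by_cases hp : p.unpair.1 ∈ C
      · obtain ⟨s, hs⟩ := (hd _).1 hp
        refine ⟨max s (p.unpair.1 + 1), ?_⟩
        have h1 : (initSeg (chi C) (max s (p.unpair.1 + 1)))[p.unpair.1]? = some 1 := by
          rw [initSeg_getElem? _ (lt_max_of_lt_right (Nat.lt_succ_self _)), chi_eq_one.2 hp]
        rw [if_neg (by rw [h1]; simp), if_pos ⟨h1, by
          rw [length_initSeg]; exact inDom_mono (le_max_left _ _) hs⟩]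
        split_ifs <;> rfl
      · refine ⟨p.unpair.1 + 1, ?_⟩
        rw [if_pos (by rw [initSeg_getElem? _ (Nat.lt_succ_self _), chi_eq_zero.2 hp])]
        rfl
    · intro p n y hy
      split_ifs at hy with h1 h2 h3
      · have hp := chi_eq_zero.1 (eq_of_initSeg_getElem? h1).symm
        rw [← Option.some.inj hy, eq_comm, chi_eq_zero]
        rintro ⟨s, hs, -⟩
        exact hp ((hd _).2 ⟨s, hs⟩)
      · rw [← Option.some.inj hy, eq_comm, chi_eq_one]
        exact ⟨_, h2.2, h3⟩
      · rw [← Option.some.inj hy, eq_comm, chi_eq_zero]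
        rintro ⟨s, hs, hlt, hnd⟩
        -- The stages `s` and `t` both come after the entry of `c` into `C`, so they see the same
        -- dumped list.
        refine h3 ⟨hlt, ?_⟩
        have h2' := h2.2
        generalize (initSeg (chi C) n).length = t at h2' ⊢
        rcases le_total s t with h | h
        · simp only [dumped_eq_of_inDom h hs]; exact hnd
        · simp only [← dumped_eq_of_inDom h h2']; exact hnd
  · let R : ℕ → (List ℕ × ℕ) → Prop := fun x q => x.unpair.1 = q.2 ∧ q.1[x]? = some 1
    have hR : PrimrecRel R := PrimrecPred.and
      (Primrec.eq.comp (Primrec.fst.comp (Primrec.unpair.comp Primrec.fst))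
        (Primrec.snd.comp Primrec.snd))
      (Primrec.eq.comp (Primrec.list_getElem?.comp (Primrec.fst.comp Primrec.snd) Primrec.fst)
        (Primrec.const _))
    classical
    refine turingReducible_of_search (F := fun σ c =>
      if σ.length = Nat.pair c (columnSize c) then
        (if ∃ x ∈ List.range σ.length, R x (σ, c) then some 1 else some 0) else none) ?_ ?_ ?_
    · refine Primrec.to_comp (Primrec.ite (Primrec.eq.comp (Primrec.list_length.comp Primrec.fst)
        (Primrec₂.natPair.comp Primrec.snd (primrec_columnSize.comp Primrec.snd)))
        (Primrec.ite ?_ (Primrec.const _) (Primrec.const _)) (Primrec.const none))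
      exact PrimrecRel.comp (PrimrecRel.exists_mem_list hR)
        (Primrec.list_range.comp (Primrec.list_length.comp Primrec.fst)) Primrec.id
    · refine fun c => ⟨Nat.pair c (columnSize c), ?_⟩
      rw [if_pos (length_initSeg _ _)]
      split_ifs <;> rfl
    · intro c n y hy
      split_ifs at hy with hn hex
      · obtain ⟨x, -, rfl, hx⟩ := hex
        rw [← Option.some.inj hy, eq_comm, chi_eq_one]
        obtain ⟨s, hs, -⟩ := chi_eq_one.1 (eq_of_initSeg_getElem? hx).symm
        exact (hd _).2 ⟨s, hs⟩
      · rw [← Option.some.inj hy, eq_comm, chi_eq_zero]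
        intro hc
        obtain ⟨s, hs⟩ := (hd c).1 hc
        obtain ⟨j, hj, hjd⟩ := exists_not_dumped d c
        have hlt : Nat.pair c j < (initSeg (chi (codeSet d)) n).length :=
          hn ▸ Nat.pair_lt_pair_right c hj
        refine hex ⟨Nat.pair c j, List.mem_range.2 hlt, by simp, ?_⟩
        rw [initSeg_getElem? _ (by simpa using hlt), chi_eq_one.2]
        refine ⟨s, by simpa using hs, by simpa using hj, ?_⟩
        rintro ⟨i, hi, rfl⟩
        exact hjd s (by simpa using hi)

/-- Every c.e. degree contains a co-infinite c.e. set. -/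
theorem IsCEDegree.exists_infinite_compl {c : TuringDegree} (hc : IsCEDegree c) :
    ∃ C : Set ℕ, IsCE C ∧ Cᶜ.Infinite ∧ deg C = c := by
  obtain ⟨W, hW, rfl⟩ := hc
  obtain ⟨d, hd⟩ := hW.exists_enumerates
  -- The set is copied onto the even numbers, so that all odd numbers are omitted.
  refine ⟨{x | ∃ s, inDom d s (x / 2) = true ∧ x % 2 = 0}, isCE_of_primrecRel
    (R := fun x s => inDom d s (x / 2) = true ∧ x % 2 = 0) (PrimrecPred.and ?_ ?_), ?_, ?_⟩
  · exact Primrec.eq.comp (primrec_inDom.comp (Primrec.pair (Primrec.pair Primrec.snd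
      (Primrec.const d)) (Primrec.nat_div.comp Primrec.fst (Primrec.const 2)))) (Primrec.const true)
  · exact Primrec.eq.comp (Primrec.nat_mod.comp Primrec.fst (Primrec.const 2)) (Primrec.const 0)
  · refine Set.infinite_of_injective_forall_mem (f := fun n : ℕ => 2 * n + 1)
      (fun a b h => by simpa using h) ?_
    rintro n ⟨s, -, h⟩
    lia
  · refine deg_eq_iff.2 ⟨?_, ?_⟩
    · refine turingReducible_of_search
        (F := fun σ x => if x % 2 = 0 then σ[x / 2]? else some 0) ?_ ?_ ?_
      · exact (Primrec.ite (Primrec.eq.comp (Primrec.nat_mod.comp Primrec.snd (Primrec.const 2))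
          (Primrec.const 0)) (Primrec.list_getElem?.comp Primrec.fst
            (Primrec.nat_div.comp Primrec.snd (Primrec.const 2))) (Primrec.const _)).to_comp
      · intro x
        refine ⟨x / 2 + 1, ?_⟩
        rw [initSeg_getElem? _ (Nat.lt_succ_self _)]
        split_ifs <;> rfl
      · intro x n y hy
        split_ifs at hy with hx
        · rw [eq_of_initSeg_getElem? hy]
          refine chi_congr ((hd _).trans ?_)
          simp [hx]
        · rw [← Option.some.inj hy, eq_comm, chi_eq_zero]
          rintro ⟨s, -, h⟩
          exact hx h
    · refine turingReducible_of_search (F := fun σ x => σ[2 * x]?) ?_ ?_ ?_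
      · exact (Primrec.list_getElem?.comp Primrec.fst
          (Primrec.nat_mul.comp (Primrec.const 2) Primrec.snd)).to_comp
      · exact fun x => ⟨2 * x + 1, by rw [initSeg_getElem? _ (Nat.lt_succ_self _)]; rfl⟩
      · intro x n y hy
        rw [eq_of_initSeg_getElem? hy]
        refine chi_congr (Iff.trans ?_ (hd _).symm)
        simp

/-- A separator of `dumpSet d` and `codeSet d` of c.e. degree that omits infinitely many elements
outside `codeSet d` has degree `0'`. -/
theorem deg_eq_zeroJump {d : Code} {Z : Set ℕ}
    (hZ : Z ∈ separatingClass (dumpSet d) (codeSet d)) (hdeg : IsCEDegree (deg Z))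
    (hinf : (Zᶜ \ codeSet d).Infinite) : deg Z = zeroJump := by
  obtain ⟨W, hW, hWZ⟩ := hdeg
  obtain ⟨dW, hdW⟩ := hW.exists_enumerates
  obtain ⟨h1, h2⟩ := deg_eq_iff.1 hWZ
  exact deg_eq_iff.2 ⟨h2.trans (turingReducible_haltingSet hW),
    haltingSet_turingReducible hZ hdW h2 h1 hinf⟩

theorem deg_eq_of_finite {d : Code} {Z : Set ℕ}
    (hZ : Z ∈ separatingClass (dumpSet d) (codeSet d)) (hfin : (Zᶜ \ codeSet d).Finite) :
    deg Z = deg (codeSet d)ᶜ := by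
  obtain ⟨N, hN⟩ := hfin.bddAbove
  have h : ∀ x, N + 1 ≤ x → (x ∈ Z ↔ x ∈ (codeSet d)ᶜ) := by
    intro x hx
    refine ⟨fun hxZ hxB => ?_, fun hxB => ?_⟩
    · exact Set.eq_empty_iff_forall_notMem.1 hZ.2 x ⟨hxZ, hxB⟩
    · by_contra hxZ
      have := hN ⟨hxZ, hxB⟩
      lia
  exact deg_eq_iff.2 ⟨turingReducible_of_eventually_eq h,
    turingReducible_of_eventually_eq fun x hx => (h x hx).symm⟩

end SeparatingSpectra

/-! ### The spectrum of the pair. -/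

theorem mainTheorem2 (c : TuringDegree) (hc : SeparatingSpectra.IsCEDegree c) :
    ∃ A B : Set ℕ, SeparatingSpectra.IsCE A ∧ SeparatingSpectra.IsCE B ∧ A ∩ B = ∅ ∧
      (A ∪ B)ᶜ.Infinite ∧
      SeparatingSpectra.spectrum (SeparatingSpectra.separatingClass A B) =
        {c, SeparatingSpectra.zeroJump} ∧
      SeparatingSpectra.deg A = SeparatingSpectra.zeroJump ∧
      SeparatingSpectra.deg Bᶜ = c := by
  open SeparatingSpectra in
  obtain ⟨C, hC, hCinf, rfl⟩ := hc.exists_infinite_compl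
  obtain ⟨d, hd⟩ := hC.exists_enumerates
  have hB : deg (codeSet d)ᶜ = deg C := (deg_compl _).trans (deg_codeSet hd)
  have hAmem : dumpSet d ∈ separatingClass (dumpSet d) (codeSet d) :=
    ⟨subset_rfl, dumpSet_inter_codeSet d⟩
  have hBmem : (codeSet d)ᶜ ∈ separatingClass (dumpSet d) (codeSet d) :=
    ⟨fun x hxA hxB => Set.eq_empty_iff_forall_notMem.1 (dumpSet_inter_codeSet d) x ⟨hxA, hxB⟩,
      Set.compl_inter_self _⟩
  have hinf := infinite_compl_union hd hCinf
  have hA : deg (dumpSet d) = zeroJump :=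
    deg_eq_zeroJump hAmem ⟨_, isCE_dumpSet d, rfl⟩
      (by rwa [Set.sdiff_eq, ← Set.compl_union])
  refine ⟨dumpSet d, codeSet d, isCE_dumpSet d, isCE_codeSet d, dumpSet_inter_codeSet d, hinf,
    ?_, hA, hB⟩
  ext w
  rw [Set.mem_insert_iff, Set.mem_singleton_iff]
  constructor
  · rintro ⟨hw, Z, hZ, rfl⟩
    -- The dichotomy behind the two degrees: finite variants of the complement of `codeSet d`, and
    -- separators that compute the halting set.
    by_cases hfin : (Zᶜ \ codeSet d).Finite
    · exact Or.inl ((deg_eq_of_finite hZ hfin).trans hB)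
    · exact Or.inr (deg_eq_zeroJump hZ hw hfin)
  · rintro (rfl | rfl)
    · exact ⟨hc, _, hBmem, hB⟩
    · exact ⟨⟨_, isCE_dumpSet d, hA⟩, _, hAmem, hA⟩
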